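/- **Setting.** A machine $U$ takes a program $p\in\{0,1\}^*$ and an input $z$, and either diverges or produces an output $U(p,z)$; we write $U(p)$ for the output on the blank input. Inputs and outputs are finite data, encoded as natural numbers in a fixed effective way, the blank input being the number $0$. $U$ is a *prefix machine* if it is partial computable and if, for each input $z$, no program on which $U(\cdot,z)$ halts is a proper prefix of another such program. A prefix machine $U$ is *universal* if for every prefix machine $V$ there is a constant $c_V$ such that for every program $p$ there is a program $p'$ of length at most $\ell(p)+c_V$ with $U(p',z)=V(p,z)$ for all inputs $z$ (with both sides defined or both undefined); here $\ell(p)$ is the length of $p$ in bits. Let $U$ be a universal prefix machine, and let $A$ be an alphabet (finite, or more generally countable with a fixed effective encoding of its letters; $A^*$ is encoded accordingly). For $x\in A^*$ let $$K_U(x)=\min\{\ell(p) : U(p)=x\}.$$ A probability distribution $\mu$ on $A^*$ is *computable* if there is an algorithm that, given $y\in A^*$ and $k\in\mathbb N$, computes $n\in\mathbb N$ with $|n/2^k-\mu(y)|\le 2^{-k}$. Let $\mathcal M$ be the set of all computable probability distributions on $A^*$. For $\mu\in\mathcal M$ let $\ell(\mu)$ be the least length of a program that computes $\mu$ on $U$,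 that is, of a program $p$ such that for all $y\in A^*$ and $k\in\mathbb N$ the output $U(p,(y,k))$ is defined and is an $n\in\mathbb N$ with $|n/2^k-\mu(y)|\le 2^{-k}$. For $x\in A^*$ put $$L_\mu(x)=\ell(\mu)-\log_2\mu(x)\in[0,\infty],$$ with $L_\mu(x)=\infty$ if $\mu(x)=0$. **Lemma A.1 (equivalence of minimum description length and Kolmogorov complexity).** There are constants $c,c'\in\mathbb R$, depending only on $U$ (and on the alphabet $A$ with its encoding), such that for every $x\in A^*$ the value $K_U(x)$ is finite, the minimum $\min_{\mu\in\mathcal M}L_\mu(x)$ is attained and finite, and $$K_U(x)\le \min_{\mu\in\mathcal M}L_\mu(x)+c \qquad\text{and}\qquad \min_{\mu\in\mathcal M}L_\mu(x)\le K_U(x)+c'.$$ -/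

import Mathlib

/-- A machine takes a program (a bit string) and an input, and either diverges or produces an
output.  Inputs and outputs are finite data (strings, pairs, numbers), represented by natural
numbers through `Encodable.encode`; the input `0` (the code of the empty string) is the blank
input. -/
abbrev Machine : Type := List Bool → ℕ →. ℕ

/-- Prefix machines: partial computable machines whose programs are self-delimiting, i.e. for each
input no halting program is a proper prefix of another halting program. -/
structure IsPrefixMachine (U : Machine) : Prop where
  partrec : Partrec₂ U
  prefixFree : ∀ (z : ℕ) (p q : List Bool), (U p z).Dom → (U q z).Dom → p <+: q → p = q

/-- Universal prefix machines: `U` is a prefix machine that simulates every prefix machine `V`,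
translating each program of `V` into a program of `U` that computes the same partial function of
the input and is longer by at most a constant depending on `V` only.  (The usual machines with
`U (ρ ++ p) = V p` for a fixed string `ρ` depending on `V` are of this kind.) -/
structure IsUniversalPrefixMachine (U : Machine) : Prop where
  isPrefixMachine : IsPrefixMachine U
  simulates : ∀ V : Machine, IsPrefixMachine V →
    ∃ c : ℕ, ∀ p : List Bool, ∃ p' : List Bool, p'.length ≤ p.length + c ∧ U p' = V p

/-- `K_U(x)`: the least length of a program that outputs the string `x` on the blank input
(`⊤` if there is none). -/
noncomputable def kolmogorovComplexity {α : Type*} [Primcodable α]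
    (U : Machine) (x : List α) : ℕ∞ :=
  ⨅ (p : List Bool) (_ : Encodable.encode x ∈ U p 0), (p.length : ℕ∞)

/-- The probability distribution `μ` on finite strings is computable: there is an algorithm that,
given a string `y` and a precision `k`, computes the numerator `n` of a dyadic rational `n / 2 ^ k`
within distance `2 ^ (-k)` of `μ(y)`. -/
def IsComputableDistribution {α : Type*} [Primcodable α] (μ : PMF (List α)) : Prop :=
  ∃ f : List α → ℕ → ℕ, Computable₂ f ∧
    ∀ (y : List α) (k : ℕ), |(f y k : ℝ) / 2 ^ k - (μ y).toReal| ≤ 1 / 2 ^ k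

/-- The program `p`, run on `U`, computes `μ`: on the input `(y, k)` it outputs the numerator `n`
of a dyadic rational `n / 2 ^ k` within distance `2 ^ (-k)` of `μ(y)`. -/
def Describes {α : Type*} [Primcodable α]
    (U : Machine) (p : List Bool) (μ : PMF (List α)) : Prop :=
  ∀ (y : List α) (k : ℕ), ∃ n ∈ U p (Encodable.encode (y, k)),
    |(n : ℝ) / 2 ^ k - (μ y).toReal| ≤ 1 / 2 ^ k

/-- `ℓ(μ)`: the number of bits needed to describe `μ` as a program that runs on `U`
(`⊤` if there is no such program). -/
noncomputable def distributionLength {α : Type*} [Primcodable α]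
    (U : Machine) (μ : PMF (List α)) : ℕ∞ :=
  ⨅ (p : List Bool) (_ : Describes U p μ), (p.length : ℕ∞)

open Classical in
/-- `-log₂ μ(x)`, which is `+∞` if `μ(x) = 0`. -/
noncomputable def codeLength {α : Type*} (μ : PMF (List α)) (x : List α) : EReal :=
  if μ x = 0 then ⊤ else ((-Real.logb 2 (μ x).toReal : ℝ) : EReal)

/-- The description length `L_μ(x) = ℓ(μ) - log₂ μ(x)`. -/
noncomputable def descriptionLength {α : Type*} [Primcodable α]
    (U : Machine) (μ : PMF (List α)) (x : List α) : EReal :=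
  ((distributionLength U μ : ENNReal) : EReal) + codeLength μ x

/-!
A short program for `x` gives a short description of the point mass at `x`
(`exists_describes_pure`), whence the minimal description length is at most `K(x)` up to a constant.

Conversely, let `p` describe `μ`. Call `(y, k)` an event if `p`, asked for `μ y` at precision `k`,
answers at least `2`; then `2⁻ᵏ ≤ μ y`. Give each event the weight `2⁻⁽ᵏ⁺¹⁾`. The weights of the
events of `y` add up to at most `μ y` (`sum_range_half_pow_le`), so all weights add up to at most
`1`, and the cumulative sums cut `[0, 1]` into disjoint intervals, one for each event, whose end
points are exact dyadic rationals computable from `p`. A word `r` of length `k + 2` whose dyadic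
interval lies in the interval of `(y, k)` is a codeword for `y` (`exists_isCodewordIn`); distinct
codewords are incomparable (`IsCodewordIn.lt_of_comparable`). Every `x` with `μ x > 0` has an event
with `k ≤ -log₂ μ(x) + 3`. Using weights that are powers of two, rather than approximations of
`μ`, makes all comparisons decidable.

The program for `x` is `p ++ r`. The machine finds `p` as the prefix that halts on input `0`, which
is unique since `U` is a prefix machine. Programs `p` that describe nothing could spoil
prefix-freeness; this is repaired by `exists_isPrefixMachine_of_partrec`, which turns an arbitrary
partial computable decoder into a prefix machine without losing any codeword that is incomparable
to all others (`exists_isPrefixMachine_decoding`).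

The minimum is attained because a program describes at most one distribution, so that only finitely
many distributions have description length below a given bound
(`finite_setOf_descriptionLength_le`).
-/

/-! ### Making a partial computable function prefix-free -/

theorem mem_rfindOpt_iff {γ : Type*} {f : ℕ → Option γ} {a : γ} :
    a ∈ Nat.rfindOpt f ↔ ∃ n, f n = some a ∧ ∀ m < n, f m = none := by
  constructor
  · intro h
    obtain ⟨n, hn, ha⟩ := Part.mem_bind_iff.1 h
    refine ⟨n, by simpa using ha, fun m hm => ?_⟩
    have hfalse : false = (f m).isSome := Part.mem_some_iff.1 (Nat.rfind_min hn hm)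
    exact Option.isSome_eq_false_iff.1 hfalse.symm |> Option.isNone_iff_eq_none.1
  · rintro ⟨n, hn, h⟩
    refine Part.mem_bind_iff.2 ⟨n, Nat.mem_rfind.2 ⟨?_, fun {m} hm => ?_⟩, ?_⟩
    · simp [hn]
    · simp [h m hm]
    · simp [hn]

/-- The graph of a partial computable function is the range of a computable function. -/
theorem exists_computable_enumeration {β : Type*} [Primcodable β] {W : β →. ℕ} (hW : Partrec W) :
    ∃ G : ℕ → Option (β × ℕ), Computable G ∧ ∀ b x, x ∈ W b ↔ ∃ t, G t = some (b, x) := by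
  obtain ⟨c, hc⟩ := Nat.Partrec.Code.exists_code.1 hW
  have key : ∀ b x, x ∈ W b ↔ ∃ s, x ∈ c.evaln s (Encodable.encode b) := by
    intro b x
    rw [← Nat.Partrec.Code.evaln_complete, hc]
    simp
  refine ⟨fun t => (c.evaln t.unpair.1 (Nat.unpair t.unpair.2).1).bind fun x =>
    (Encodable.decode (α := β) (Nat.unpair t.unpair.2).1).bind fun b =>
      if Encodable.encode b = (Nat.unpair t.unpair.2).1 then some (b, x) else none, ?_, ?_⟩
  · have h1 : Primrec fun t : ℕ => (Nat.unpair t.unpair.2).1 :=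
      Primrec.fst.comp (Primrec.unpair.comp (Primrec.snd.comp Primrec.unpair))
    refine Primrec.to_comp ?_
    refine Primrec.option_bind (Nat.Partrec.Code.primrec_evaln.comp
      (((Primrec.fst.comp Primrec.unpair).pair (Primrec.const c)).pair h1)) ?_
    refine Primrec.option_bind (Primrec.decode.comp (h1.comp Primrec.fst)) ?_
    exact Primrec.ite (Primrec.eq.comp (Primrec.encode.comp Primrec.snd)
        (h1.comp (Primrec.fst.comp Primrec.fst)))
      (Primrec.option_some.comp (Primrec.snd.pair (Primrec.snd.comp Primrec.fst)))
      (Primrec.const none)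
  · intro b x
    rw [key]
    constructor
    · rintro ⟨s, hs⟩
      exact ⟨Nat.pair s (Nat.pair (Encodable.encode b) 0), by simp [Option.mem_def.1 hs]⟩
    · rintro ⟨t, ht⟩
      simp only [Option.bind_eq_some_iff] at ht
      obtain ⟨x', hx', b', hb', h⟩ := ht
      split_ifs at h with h2
      simp only [Option.some.injEq, Prod.mk.injEq] at h
      obtain ⟨rfl, rfl⟩ := h
      exact ⟨t.unpair.1, by rw [h2]; exact hx'⟩

theorem take_length_eq_take_length_iff {γ : Type*} {p q : List γ} :
    p.take q.length = q.take p.length ↔ p <+: q ∨ q <+: p := by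
  constructor
  · intro h
    rcases le_total p.length q.length with hl | hl
    · exact Or.inl (List.prefix_iff_eq_take.2 (by rwa [List.take_of_length_le hl] at h))
    · rw [List.take_of_length_le hl] at h
      exact Or.inr (List.prefix_iff_eq_take.2 h.symm)
  · rintro (⟨r, rfl⟩ | ⟨r, rfl⟩) <;> simp

/-- Given a partial computable `W` and codewords `word b`, there is a prefix machine that outputs
`W b` on the program `word b`, at least if every halting computation of `W` with a codeword
comparable to `word b` has that same codeword and the same output.  It enumerates the halting
computations of `W` until one with a codeword comparable to its program appears, and answers only if
that codeword is the program.  Thus it is a prefix machine whatever `W` is. -/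
theorem exists_isPrefixMachine_of_partrec {β : Type*} [Primcodable β] {W : β →. ℕ}
    (hW : Partrec W) {word : β → List Bool} (hword : Computable word) :
    ∃ V : Machine, IsPrefixMachine V ∧ ∀ b x, x ∈ W b →
      (∀ b' x', x' ∈ W b' → (word b' <+: word b ∨ word b <+: word b') →
        word b' = word b ∧ x' = x) → ∀ z, x ∈ V (word b) z := by
  obtain ⟨G, hG, hGW⟩ := exists_computable_enumeration hW
  let F : List Bool → ℕ → Option (Option ℕ) := fun q t => (G t).bind fun a =>
    bif decide ((word a.1).take q.length = q.take (word a.1).length) then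
      some (bif decide (word a.1 = q) then some a.2 else none) else none
  have hF : Computable₂ F := by
    have hw : Computable fun a : (List Bool × ℕ) × (β × ℕ) => word a.2.1 :=
      hword.comp (Computable.fst.comp Computable.snd)
    have hq : Computable fun a : (List Bool × ℕ) × (β × ℕ) => a.1.1 :=
      Computable.fst.comp Computable.fst
    have heq : Computable₂ fun p q : List Bool => decide (p = q) := Primrec.eq.decide.to_comp
    have htake : Computable₂ (List.take : ℕ → List Bool → List Bool) := Primrec.list_take.to_comp
    refine Computable.option_bind (hG.comp Computable.snd) ?_
    refine Computable.cond ?_ ?_ (Computable.const none)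
    · exact heq.comp (htake.comp (Computable.list_length.comp hq) hw)
        (htake.comp (Computable.list_length.comp hw) hq)
    · exact Computable.option_some.comp (Computable.cond (heq.comp hw hq)
        (Computable.option_some.comp (Computable.snd.comp Computable.snd)) (Computable.const none))
  have hF_some : ∀ q t o, F q t = some o ↔ ∃ b x, G t = some (b, x) ∧
      (word b <+: q ∨ q <+: word b) ∧ o = if word b = q then some x else none := by
    intro q t o
    simp only [F, Option.bind_eq_some_iff, Prod.exists, ← take_length_eq_take_length_iff]
    refine exists₂_congr fun b x => and_congr_right fun _ => ?_
    by_cases h : (word b).take q.length = q.take (word b).length <;>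
      by_cases h' : word b = q <;> simp [h, h', eq_comm]
  let V : Machine := fun q _ => (Nat.rfindOpt (F q)).bind fun o => (o : Part ℕ)
  have hV : ∀ q z x, x ∈ V q z ↔ ∃ t, F q t = some (some x) ∧ ∀ s < t, F q s = none := by
    intro q z x
    simp only [V, Part.mem_bind_iff, mem_rfindOpt_iff, Part.mem_coe, Option.mem_def]
    simp
  refine ⟨V, ⟨?_, ?_⟩, ?_⟩
  · exact ((Partrec.rfindOpt hF).comp Computable.fst).bind
      (Computable.ofOption Computable.snd)
  · intro z p q hp hq hpq
    obtain ⟨x, hx⟩ := Part.dom_iff_mem.1 hp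
    obtain ⟨y, hy⟩ := Part.dom_iff_mem.1 hq
    obtain ⟨s, hs, hs'⟩ := (hV _ z _).1 hx
    obtain ⟨t, ht, ht'⟩ := (hV _ z _).1 hy
    obtain ⟨b, u, hb, -, hbx⟩ := (hF_some _ _ _).1 hs
    obtain ⟨b', u', hb', -, hby⟩ := (hF_some _ _ _).1 ht
    have hbp : word b = p := by by_contra h; simp [h] at hbx
    have hbq : word b' = q := by by_contra h; simp [h] at hby
    -- Each of the two words is met in the other's search, so both searches stop at the same time.
    have h1 : ¬ s < t := fun h => by
      have := (hF_some q s _).2 ⟨b, u, hb, Or.inl (hbp ▸ hpq), rfl⟩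
      simp [ht' s h] at this
    have h2 : ¬ t < s := fun h => by
      have := (hF_some p t _).2 ⟨b', u', hb', Or.inr (hbq ▸ hpq), rfl⟩
      simp [hs' t h] at this
    have hst : s = t := by omega
    subst hst
    rw [hb] at hb'
    cases hb'
    exact hbp.symm.trans hbq
  · intro b x hx huniq z
    have hex : ∃ t, ∃ o, F (word b) t = some o := by
      obtain ⟨t, ht⟩ := (hGW _ _).1 hx
      exact ⟨t, _, (hF_some _ _ _).2 ⟨b, x, ht, Or.inl List.prefix_rfl, rfl⟩⟩
    classical
    obtain ⟨o, ho⟩ := Nat.find_spec hex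
    refine (hV _ z _).2 ⟨Nat.find hex, ?_, fun s hs => ?_⟩
    · obtain ⟨b', x', hb', hc, rfl⟩ := (hF_some _ _ _).1 ho
      obtain ⟨h1, rfl⟩ := huniq b' x' ((hGW _ _).2 ⟨_, hb'⟩) hc
      rw [ho, if_pos h1]
    · exact Option.eq_none_iff_forall_ne_some.2 fun o h => Nat.find_min hex hs ⟨o, h⟩

/-! ### Binary words and dyadic intervals -/

/-- The number whose binary expansion, most significant bit first, is `r`. -/
def binaryValue (r : List Bool) : ℕ := r.foldl (fun v b => 2 * v + b.toNat) 0

theorem primrec_binaryValue : Primrec binaryValue := by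
  have htoNat : Primrec Bool.toNat := Primrec.dom_finite _
  refine Primrec.list_foldl (f := fun r : List Bool => r) (g := fun _ => 0)
    (h := fun _ s => 2 * s.1 + s.2.toNat) Primrec.id (Primrec.const 0) ?_
  exact Primrec.nat_add.comp
    (Primrec.nat_mul.comp (Primrec.const 2) (Primrec.fst.comp Primrec.snd))
    (htoNat.comp (Primrec.snd.comp Primrec.snd))

theorem binaryValue_concat (r : List Bool) (b : Bool) :
    binaryValue (r ++ [b]) = 2 * binaryValue r + b.toNat := by
  simp [binaryValue]

theorem binaryValue_append_bounds (r s : List Bool) :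
    binaryValue r * 2 ^ s.length ≤ binaryValue (r ++ s) ∧
      binaryValue (r ++ s) < (binaryValue r + 1) * 2 ^ s.length := by
  induction s using List.reverseRecOn with
  | nil => simp
  | append_singleton s b ih =>
    rw [← List.append_assoc, binaryValue_concat]
    have hb := Bool.toNat_le b
    simp only [List.length_append, List.length_singleton, pow_succ]
    constructor <;> nlinarith [ih.1, ih.2]

theorem exists_binaryValue_eq (l v : ℕ) (hv : v < 2 ^ l) :
    ∃ r : List Bool, r.length = l ∧ binaryValue r = v := by
  induction l generalizing v with
  | zero => exact ⟨[], rfl, by simp at hv; simp [binaryValue, hv]⟩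
  | succ l ih =>
    obtain ⟨r, hr, hrv⟩ := ih (v / 2) (by rw [pow_succ] at hv; omega)
    refine ⟨r ++ [decide (v % 2 = 1)], by simp [hr], ?_⟩
    rw [binaryValue_concat, hrv]
    rcases Nat.mod_two_eq_zero_or_one v with h | h <;> simp [h] <;> omega

/-- The dyadic interval `[v / 2 ^ l, (v + 1) / 2 ^ l]` of the word `r`, where `l` is its length and
`v` its binary value, is contained in `[a, b]`. -/
def IsCodewordIn (a b : ℝ) (r : List Bool) : Prop :=
  a ≤ (binaryValue r : ℝ) / 2 ^ r.length ∧ ((binaryValue r : ℝ) + 1) / 2 ^ r.length ≤ b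

/-- Comparable words have overlapping dyadic intervals. -/
theorem IsCodewordIn.lt_of_comparable {a b a' b' : ℝ} {r r' : List Bool} (h : IsCodewordIn a b r)
    (h' : IsCodewordIn a' b' r') (hrr' : r <+: r' ∨ r' <+: r) : a < b' ∧ a' < b := by
  wlog hp : r <+: r' generalizing a b a' b' r r'
  · exact (this h' h hrr'.symm (hrr'.resolve_left hp)).symm
  obtain ⟨s, rfl⟩ := hp
  obtain ⟨h1, h2⟩ := binaryValue_append_bounds r s
  have h1' : (binaryValue r : ℝ) * 2 ^ s.length ≤ binaryValue (r ++ s) := by exact_mod_cast h1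
  have h2' : (binaryValue (r ++ s) : ℝ) < (binaryValue r + 1) * 2 ^ s.length := by
    exact_mod_cast h2
  obtain ⟨ha, hb⟩ := h
  obtain ⟨ha', hb'⟩ := h'
  rw [List.length_append, pow_add] at ha' hb'
  have hlow : (binaryValue r : ℝ) / 2 ^ r.length ≤
      binaryValue (r ++ s) / (2 ^ r.length * 2 ^ s.length) := by
    rw [div_le_div_iff₀ (by positivity) (by positivity)]
    have : (0 : ℝ) < 2 ^ r.length := by positivity
    nlinarith
  have hhigh : (binaryValue (r ++ s) : ℝ) / (2 ^ r.length * 2 ^ s.length) <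
      (binaryValue r + 1) / 2 ^ r.length := by
    rw [div_lt_div_iff₀ (by positivity) (by positivity)]
    have : (0 : ℝ) < 2 ^ r.length := by positivity
    nlinarith
  have hlt : (binaryValue (r ++ s) : ℝ) / (2 ^ r.length * 2 ^ s.length) <
      (binaryValue (r ++ s) + 1) / (2 ^ r.length * 2 ^ s.length) := by
    gcongr; linarith
  constructor <;> linarith

/-- An interval of length at least `2 / 2 ^ l` contains the dyadic interval of a word of
length `l`. -/
theorem exists_isCodewordIn {a b : ℝ} {l : ℕ} (ha : 0 ≤ a) (hb : b ≤ 1)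
    (hab : a + 2 / 2 ^ l ≤ b) : ∃ r : List Bool, r.length = l ∧ IsCodewordIn a b r := by
  have hl : (0 : ℝ) < 2 ^ l := by positivity
  have hv1 := Nat.le_ceil (a * 2 ^ l)
  have hv2 := Nat.ceil_lt_add_one (mul_nonneg ha hl.le)
  have hab' : a * 2 ^ l + 2 ≤ b * 2 ^ l := by
    have := mul_le_mul_of_nonneg_right hab hl.le
    rwa [add_mul, div_mul_cancel₀ _ hl.ne'] at this
  have hb' : b * 2 ^ l ≤ 2 ^ l := by nlinarith
  obtain ⟨r, hr, hrv⟩ := exists_binaryValue_eq l ⌈a * 2 ^ l⌉₊ (by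
    have : (⌈a * 2 ^ l⌉₊ : ℝ) < 2 ^ l := by linarith
    exact_mod_cast this)
  refine ⟨r, hr, ?_, ?_⟩
  · rw [hr, hrv, le_div_iff₀ hl]
    exact hv1
  · rw [hr, hrv, div_le_iff₀ hl]
    linarith

/-! ### Decoding a distribution-relative code -/

/-- `e` is the code of a pair `(y, k)` of a string and a precision.  The decoder may be defined on
numbers that are not codes, on which a program describing a distribution is free to diverge, so the
test re-encodes the decoded value. -/
def isEvent (α : Type*) [Primcodable α] (e : ℕ) : Bool :=
  decide (Encodable.encode (Encodable.decode (α := List α × ℕ) e) = e + 1)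

theorem isEvent_iff {α : Type*} [Primcodable α] {e : ℕ} :
    isEvent α e = true ↔ ∃ a : List α × ℕ, Encodable.encode a = e := by
  rw [isEvent, decide_eq_true_iff]
  constructor
  · intro h
    cases hd : Encodable.decode (α := List α × ℕ) e with
    | none => simp [hd] at h
    | some a => exact ⟨a, by simpa [hd] using h⟩
  · rintro ⟨a, rfl⟩
    simp

theorem computable_isEvent (α : Type*) [Primcodable α] : Computable (isEvent α) :=
  (Primrec.eq.decide.comp (Primrec.encode.comp Primrec.decode) Primrec.succ).to_comp

/-- The weight that the program `p` assigns to the event `e`, the code of `(y, k)`: it is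
`2 ^ (-(k + 1))` if `p` outputs some `n ≥ 2`, which certifies `2 ^ (-k) ≤ μ y`, and `0` otherwise.
It is stored as an integer, scaled by `2 ^ (e + 1)`; the subtraction `e - k` does not truncate
because `k ≤ e` by the choice of the pairing function. -/
noncomputable def eventWeight (α : Type*) [Primcodable α] (U : Machine) (p : List Bool) (e : ℕ) :
    Part ℕ :=
  bif isEvent α e then (U p e).map fun n => bif decide (2 ≤ n) then 2 ^ (e - e.unpair.2) else 0
  else Part.some 0

/-- The sum of the weights of the events before `e`, scaled by `2 ^ (e + 1)`; it is defined if all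
these weights are. -/
noncomputable def cumulativeWeight (α : Type*) [Primcodable α] (U : Machine) (p : List Bool)
    (e : ℕ) : Part ℕ :=
  e.rec (Part.some 0) fun i N => N.bind fun n => (eventWeight α U p i).map fun w => 2 * (n + w)

/-- The word `r` has length `k + 2`, where `k` is the precision of the event `e`, and its dyadic
interval is contained in the interval of `e`, given the scaled sum `N` of the weights of the earlier
events and the scaled weight `w` of `e`. -/
def codewordTest (r : List Bool) (e N w : ℕ) : Bool :=
  decide (r.length = e.unpair.2 + 2) &&
    (decide (N * 2 ^ r.length ≤ binaryValue r * 2 ^ (e + 1)) &&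
      decide ((binaryValue r + 1) * 2 ^ (e + 1) ≤ (N + w) * 2 ^ r.length))

theorem codewordTest_iff {r : List Bool} {e N w : ℕ} : codewordTest r e N w = true ↔
    r.length = e.unpair.2 + 2 ∧
      IsCodewordIn ((N : ℝ) / 2 ^ (e + 1)) (((N : ℝ) + w) / 2 ^ (e + 1)) r := by
  simp only [codewordTest, Bool.and_eq_true, decide_eq_true_iff, IsCodewordIn]
  rw [div_le_div_iff₀ (by positivity) (by positivity),
    div_le_div_iff₀ (by positivity) (by positivity)]
  norm_cast

/-- The decoder: on `((p, r), e)`, with `e` the code of `(y, k)`, it outputs the code of `y` if `r`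
is a codeword for the event `e` under the weights computed by `p`.  It first waits for `p` to halt
on input `0`, so that the domain of `U` at this one input delimits `p` within `p ++ r`. -/
noncomputable def eventDecoder (α : Type*) [Primcodable α] (U : Machine) :
    (List Bool × List Bool) × ℕ →. ℕ := fun a =>
  (U a.1.1 0).bind fun _ => (cumulativeWeight α U a.1.1 a.2).bind fun N =>
    (eventWeight α U a.1.1 a.2).bind fun w =>
      ((bif codewordTest a.1.2 a.2 N w then some a.2.unpair.1 else none : Option ℕ) : Part ℕ)

theorem primrec_two_pow : Primrec fun n : ℕ => 2 ^ n :=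
  (Primrec₂.unpaired'.1 Nat.Primrec.pow).comp (Primrec.const 2) Primrec.id

theorem partrec_eventWeight (α : Type*) [Primcodable α] {U : Machine} (hU : Partrec₂ U) :
    Partrec₂ (eventWeight α U) := by
  refine Partrec.cond ((computable_isEvent α).comp Computable.snd) ?_ (Partrec.some.comp
    (Computable.const 0))
  refine Partrec.map hU ?_
  refine Computable.cond (Primrec.nat_le.decide.to_comp.comp (Computable.const 2) Computable.snd)
    ?_ (Computable.const 0)
  have he : Primrec fun a : (List Bool × ℕ) × ℕ => a.1.2 := Primrec.snd.comp Primrec.fst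
  exact (primrec_two_pow.comp
    (Primrec.nat_sub.comp he (Primrec.snd.comp (Primrec.unpair.comp he)))).to_comp

theorem partrec_cumulativeWeight (α : Type*) [Primcodable α] {U : Machine} (hU : Partrec₂ U) :
    Partrec₂ (cumulativeWeight α U) := by
  refine Partrec.nat_rec (f := fun a : List Bool × ℕ => a.2) (g := fun _ => Part.some 0)
    (h := fun a b => (eventWeight α U a.1 b.1).map fun w => 2 * (b.2 + w))
    Computable.snd (Partrec.some.comp (Computable.const 0)) ?_
  refine Partrec.map ((partrec_eventWeight α hU).comp (Computable.fst.comp Computable.fst)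
    (Computable.fst.comp Computable.snd)) ?_
  exact (Primrec.nat_mul.comp (Primrec.const 2) (Primrec.nat_add.comp
    (Primrec.snd.comp (Primrec.snd.comp Primrec.fst)) Primrec.snd)).to_comp

theorem primrec_codewordTest :
    Primrec fun a : (List Bool × ℕ) × ℕ × ℕ => codewordTest a.1.1 a.1.2 a.2.1 a.2.2 := by
  have hr : Primrec fun a : (List Bool × ℕ) × ℕ × ℕ => a.1.1 := Primrec.fst.comp Primrec.fst
  have he : Primrec fun a : (List Bool × ℕ) × ℕ × ℕ => a.1.2 := Primrec.snd.comp Primrec.fst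
  have hN : Primrec fun a : (List Bool × ℕ) × ℕ × ℕ => a.2.1 := Primrec.fst.comp Primrec.snd
  have hw : Primrec fun a : (List Bool × ℕ) × ℕ × ℕ => a.2.2 := Primrec.snd.comp Primrec.snd
  have hl := Primrec.list_length.comp hr
  have hv := primrec_binaryValue.comp hr
  have hpl := primrec_two_pow.comp hl
  have hpe := primrec_two_pow.comp (Primrec.succ.comp he)
  refine Primrec.and.comp (Primrec.eq.decide.comp hl (Primrec.nat_add.comp
    (Primrec.snd.comp (Primrec.unpair.comp he)) (Primrec.const 2))) (Primrec.and.comp ?_ ?_)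
  · exact Primrec.nat_le.decide.comp (Primrec.nat_mul.comp hN hpl) (Primrec.nat_mul.comp hv hpe)
  · exact Primrec.nat_le.decide.comp (Primrec.nat_mul.comp (Primrec.succ.comp hv) hpe)
      (Primrec.nat_mul.comp (Primrec.nat_add.comp hN hw) hpl)

theorem partrec_bind_bind_ofOption {β γ δ σ τ : Type*} [Primcodable β] [Primcodable γ]
    [Primcodable δ] [Primcodable σ] [Primcodable τ] {u : β →. γ} {f : β →. δ} {g : β →. σ}
    {h : (β × δ) × σ → Option τ} (hu : Partrec u) (hf : Partrec f) (hg : Partrec g)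
    (hh : Computable h) :
    Partrec fun b => (u b).bind fun _ => (f b).bind fun d => (g b).bind fun s =>
      (h ((b, d), s) : Part τ) := by
  have h1 : Partrec fun a : (β × δ) × σ => (h a : Part τ) := Computable.ofOption hh
  have h2 : Partrec fun a : β × δ => (g a.1).bind fun s => (h (a, s) : Part τ) :=
    (hg.comp Computable.fst).bind h1.to₂
  have h3 : Partrec fun b : β => (f b).bind fun d => (g b).bind fun s =>
      (h ((b, d), s) : Part τ) := hf.bind h2.to₂
  exact hu.bind (h3.comp Computable.fst).to₂

theorem partrec_eventDecoder (α : Type*) [Primcodable α] {U : Machine} (hU : Partrec₂ U) :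
    Partrec (eventDecoder α U) := by
  have hp : Computable fun a : (List Bool × List Bool) × ℕ => a.1.1 :=
    Computable.fst.comp Computable.fst
  have ha : Primrec fun a : (((List Bool × List Bool) × ℕ) × ℕ) × ℕ => a.1.1 :=
    Primrec.fst.comp Primrec.fst
  have htest : Primrec fun a : (((List Bool × List Bool) × ℕ) × ℕ) × ℕ =>
      codewordTest a.1.1.1.2 a.1.1.2 a.1.2 a.2 :=
    primrec_codewordTest.comp
      (((Primrec.snd.comp (Primrec.fst.comp ha)).pair (Primrec.snd.comp ha)).pair
        ((Primrec.snd.comp Primrec.fst).pair Primrec.snd))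
  exact partrec_bind_bind_ofOption
    (h := fun a : (((List Bool × List Bool) × ℕ) × ℕ) × ℕ =>
      bif codewordTest a.1.1.1.2 a.1.1.2 a.1.2 a.2 then some a.1.1.2.unpair.1 else none)
    (Partrec₂.comp hU hp (Computable.const 0))
    (Partrec₂.comp (partrec_cumulativeWeight α hU) hp Computable.snd)
    (Partrec₂.comp (partrec_eventWeight α hU) hp Computable.snd)
    (Primrec.cond htest (Primrec.option_some.comp
      (Primrec.fst.comp (Primrec.unpair.comp (Primrec.snd.comp ha))))
      (Primrec.const none)).to_comp

/-! ### Event weights of a described distribution -/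

open Encodable in
theorem eventWeight_encode {α : Type*} [Primcodable α] (U : Machine) (p : List Bool) (y : List α)
    (k : ℕ) : eventWeight α U p (encode (y, k)) =
      (U p (encode (y, k))).map fun n => if 2 ≤ n then 2 ^ (encode (y, k) - k) else 0 := by
  rw [eventWeight, isEvent_iff.2 ⟨(y, k), rfl⟩, cond_true]
  simp [encode_prod_val, Bool.cond_decide]

theorem cumulativeWeight_succ {α : Type*} [Primcodable α] (U : Machine) (p : List Bool) (e : ℕ) :
    cumulativeWeight α U p (e + 1) = (cumulativeWeight α U p e).bind fun n =>
      (eventWeight α U p e).map fun w => 2 * (n + w) := rfl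

theorem eventWeight_of_not_isEvent {α : Type*} [Primcodable α] (U : Machine) (p : List Bool)
    {e : ℕ} (he : isEvent α e = false) : eventWeight α U p e = Part.some 0 := by
  rw [eventWeight, he, cond_false]

/-- The binary fractions `2⁻ᵏ` below `m`, each counted with half its size, add up to at most `m`.
The bound `m - 2⁻ⁿ` on the partial sums is what makes the induction go through. -/
theorem sum_range_half_pow_le (m : ℝ) (n : ℕ) :
    ∑ k ∈ Finset.range n, (if 1 / 2 ^ k ≤ m then (1 : ℝ) / 2 ^ (k + 1) else 0) ≤
      max 0 (m - 1 / 2 ^ n) := by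
  induction n with
  | zero => simp
  | succ n ih =>
    rw [Finset.sum_range_succ]
    have h2 : (1 : ℝ) / 2 ^ n = 2 * (1 / 2 ^ (n + 1)) := by rw [pow_succ]; field_simp
    split_ifs with h
    · refine le_max_of_le_right ?_
      rw [max_eq_right (by linarith)] at ih
      linarith
    · rw [max_eq_left (by linarith)] at ih
      exact le_max_of_le_left (by linarith)

open Encodable in
/-- A program describing `μ` assigns a weight to every event; the weight of `(y, k)` is positive
only if `2⁻ᵏ ≤ μ y`, and surely so if `3 · 2⁻ᵏ ≤ μ y`. -/
theorem exists_weights_of_describes {α : Type*} [Primcodable α] {U : Machine} {p : List Bool}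
    {μ : PMF (List α)} (h : Describes U p μ) :
    ∃ w : ℕ → ℕ, (∀ e, eventWeight α U p e = Part.some (w e)) ∧
      (∀ e, isEvent α e = false → w e = 0) ∧
      (∀ (y : List α) k, w (encode (y, k)) ≠ 0 → 1 / 2 ^ k ≤ (μ y).toReal) ∧
      (∀ (y : List α) k, w (encode (y, k)) ≤ 2 ^ (encode (y, k) - k)) ∧
      ∀ (y : List α) k, 3 / 2 ^ k ≤ (μ y).toReal → w (encode (y, k)) = 2 ^ (encode (y, k) - k) := by
  choose f hf hfμ using h
  have hw : ∀ y k, eventWeight α U p (encode (y, k)) =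
      Part.some (if 2 ≤ f y k then 2 ^ (encode (y, k) - k) else 0) := fun y k => by
    rw [eventWeight_encode, Part.eq_some_iff.2 (hf y k), Part.map_some]
  have hex : ∀ e, ∃ w, eventWeight α U p e = Part.some w := by
    intro e
    cases he : isEvent α e with
    | false => exact ⟨0, eventWeight_of_not_isEvent U p he⟩
    | true =>
      obtain ⟨⟨y, k⟩, rfl⟩ := isEvent_iff.1 he
      exact ⟨_, hw y k⟩
  choose w hw' using hex
  have hwf : ∀ y k, w (encode (y, k)) = if 2 ≤ f y k then 2 ^ (encode (y, k) - k) else 0 :=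
    fun y k => Part.some_inj.1 ((hw' _).symm.trans (hw y k))
  refine ⟨w, hw', fun e he => ?_, fun y k hne => ?_, fun y k => ?_, fun y k hk => ?_⟩
  · exact Part.some_inj.1 ((hw' e).symm.trans (eventWeight_of_not_isEvent U p he))
  · have h2 : 2 ≤ f y k := by
      by_contra h2
      exact hne (by rw [hwf, if_neg h2])
    have h2' : (2 : ℝ) ≤ f y k := by exact_mod_cast h2
    have h3 : (2 : ℝ) / 2 ^ k ≤ f y k / 2 ^ k := by gcongr
    have h4 := (abs_le.1 (hfμ y k)).2
    rw [div_eq_mul_one_div] at h3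
    linarith
  · rw [hwf]
    split_ifs <;> simp
  · have h4 := (abs_le.1 (hfμ y k)).1
    rw [div_eq_mul_one_div] at hk
    have h5 : (2 : ℝ) / 2 ^ k ≤ f y k / 2 ^ k := by
      rw [div_eq_mul_one_div 2]
      linarith
    have h6 : (2 : ℝ) ≤ f y k := (div_le_div_iff_of_pos_right (by positivity)).1 h5
    rw [hwf, if_pos (by exact_mod_cast h6)]

open Encodable in
/-- Kraft's inequality for the event weights: those of the pairs `(y, k)` with `y` fixed add up to
at most `μ y`. -/
theorem sum_weights_le_one {α : Type*} [Primcodable α] (μ : PMF (List α)) (w : ℕ → ℕ)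
    (h0 : ∀ e, isEvent α e = false → w e = 0)
    (hμ : ∀ y k, w (encode (y, k)) ≠ 0 → 1 / 2 ^ k ≤ (μ y).toReal)
    (hle : ∀ (y : List α) k, w (encode (y, k)) ≤ 2 ^ (encode (y, k) - k)) (n : ℕ) :
    ∑ e ∈ Finset.range n, (w e : ℝ) / 2 ^ (e + 1) ≤ 1 := by
  set v : ℕ → ENNReal := fun e => ENNReal.ofReal ((w e : ℝ) / 2 ^ (e + 1)) with hv
  have hterm : ∀ (y : List α) k, v (encode (y, k)) ≤
      ENNReal.ofReal (if 1 / 2 ^ k ≤ (μ y).toReal then (1 : ℝ) / 2 ^ (k + 1) else 0) := by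
    intro y k
    refine ENNReal.ofReal_le_ofReal ?_
    split_ifs with h
    · have hk : k ≤ encode (y, k) := by
        rw [encode_prod_val]; exact Nat.right_le_pair _ _
      have h1 : (w (encode (y, k)) : ℝ) ≤ 2 ^ (encode (y, k) - k) := by exact_mod_cast hle y k
      rw [div_le_div_iff₀ (by positivity) (by positivity)]
      calc (w (encode (y, k)) : ℝ) * 2 ^ (k + 1) ≤ 2 ^ (encode (y, k) - k) * 2 ^ (k + 1) := by
            gcongr
        _ = 1 * 2 ^ (encode (y, k) + 1) := by rw [← pow_add, one_mul]; congr 1; omega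
    · have : w (encode (y, k)) = 0 := by
        by_contra hne
        exact h (hμ y k hne)
      rw [this, Nat.cast_zero, zero_div]
  have hsupp : Function.support v ⊆ Set.range (encode : List α × ℕ → ℕ) := by
    intro e he
    by_contra hne
    have : isEvent α e = false := by
      rw [← Bool.not_eq_true, isEvent_iff]
      exact hne
    exact he (by simp [hv, h0 e this])
  have htotal : ∑' e, v e ≤ 1 := by
    rw [← encode_injective.tsum_eq hsupp, ENNReal.tsum_prod' (f := fun a => v (encode a)),
      ← μ.tsum_coe]
    refine ENNReal.tsum_le_tsum fun y => ENNReal.tsum_le_of_sum_range_le fun m => ?_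
    calc ∑ k ∈ Finset.range m, v (encode (y, k))
        ≤ ∑ k ∈ Finset.range m, ENNReal.ofReal
            (if 1 / 2 ^ k ≤ (μ y).toReal then (1 : ℝ) / 2 ^ (k + 1) else 0) :=
          Finset.sum_le_sum fun k _ => hterm y k
      _ = ENNReal.ofReal (∑ k ∈ Finset.range m,
            (if 1 / 2 ^ k ≤ (μ y).toReal then (1 : ℝ) / 2 ^ (k + 1) else 0)) := by
          rw [ENNReal.ofReal_sum_of_nonneg]
          intro k _
          positivity
      _ ≤ ENNReal.ofReal (μ y).toReal := by
          refine ENNReal.ofReal_le_ofReal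
            ((sum_range_half_pow_le _ m).trans ?_)
          refine max_le ENNReal.toReal_nonneg (sub_le_self _ (by positivity))
      _ = μ y := ENNReal.ofReal_toReal (μ.apply_ne_top y)
  have hfin : ENNReal.ofReal (∑ e ∈ Finset.range n, (w e : ℝ) / 2 ^ (e + 1)) ≤ 1 := by
    rw [ENNReal.ofReal_sum_of_nonneg fun e _ => by positivity]
    exact (ENNReal.sum_le_tsum _).trans htotal
  exact ENNReal.ofReal_le_one.1 hfin

theorem exists_cumulativeWeight_eq {α : Type*} [Primcodable α] {U : Machine} {p : List Bool}
    {w : ℕ → ℕ} (hw : ∀ e, eventWeight α U p e = Part.some (w e)) (e : ℕ) :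
    ∃ N : ℕ, cumulativeWeight α U p e = Part.some N ∧
      (N : ℝ) / 2 ^ (e + 1) = ∑ j ∈ Finset.range e, (w j : ℝ) / 2 ^ (j + 1) := by
  induction e with
  | zero => exact ⟨0, rfl, by simp⟩
  | succ e ih =>
    obtain ⟨N, hN, hsum⟩ := ih
    refine ⟨2 * (N + w e), ?_, ?_⟩
    · rw [cumulativeWeight_succ, hN, Part.bind_some, hw e, Part.map_some]
    · rw [Finset.sum_range_succ, ← hsum, pow_succ (2 : ℝ) (e + 1)]
      push_cast
      field_simp

/-- The number `0` is the code of the pair of the empty string and the precision `0`. -/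
theorem dom_zero_of_describes {α : Type*} [Primcodable α] {U : Machine} {p : List Bool}
    {μ : PMF (List α)} (h : Describes U p μ) : (U p 0).Dom := by
  obtain ⟨n, hn, -⟩ := h [] 0
  exact Part.dom_iff_mem.2 ⟨n, hn⟩

/-- If all event weights of `p` are defined, then the codewords that the decoder accepts for the
event `e` are exactly those of the right length in the interval of `e`. -/
theorem mem_eventDecoder_iff {α : Type*} [Primcodable α] {U : Machine} {p : List Bool}
    {w : ℕ → ℕ} (hw : ∀ e, eventWeight α U p e = Part.some (w e)) (hp : (U p 0).Dom)
    {r : List Bool} {e x : ℕ} :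
    x ∈ eventDecoder α U ((p, r), e) ↔ x = e.unpair.1 ∧ r.length = e.unpair.2 + 2 ∧
      IsCodewordIn (∑ j ∈ Finset.range e, (w j : ℝ) / 2 ^ (j + 1))
        (∑ j ∈ Finset.range (e + 1), (w j : ℝ) / 2 ^ (j + 1)) r := by
  obtain ⟨N, hN, hsum⟩ := exists_cumulativeWeight_eq hw e
  obtain ⟨u, hu⟩ := Part.dom_iff_mem.1 hp
  rw [Finset.sum_range_succ, ← hsum, ← add_div, ← codewordTest_iff]
  simp only [eventDecoder, hN, hw e, Part.eq_some_iff.2 hu, Part.bind_some]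
  cases codewordTest r e N (w e) <;> simp

open Encodable in
/-- Shannon–Fano–Elias coding relative to a described distribution: some prefix machine produces
each `x` from a program for `μ` followed by a codeword of about `-log₂ μ(x)` bits. -/
theorem exists_isPrefixMachine_decoding (α : Type*) [Primcodable α] {U : Machine}
    (hU : IsPrefixMachine U) :
    ∃ V : Machine, IsPrefixMachine V ∧ ∀ (p : List Bool) (μ : PMF (List α)), Describes U p μ →
      ∀ x, μ x ≠ 0 → ∃ q : List Bool, encode x ∈ V q 0 ∧
        (q.length : ℝ) ≤ p.length - Real.logb 2 (μ x).toReal + 5 := by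
  have hword : Computable fun a : (List Bool × List Bool) × ℕ => a.1.1 ++ a.1.2 :=
    Computable.list_append.comp (Computable.fst.comp Computable.fst)
      (Computable.snd.comp Computable.fst)
  obtain ⟨V, hV, hVspec⟩ := exists_isPrefixMachine_of_partrec
    (partrec_eventDecoder α hU.partrec) hword
  refine ⟨V, hV, fun p μ hpμ x hx => ?_⟩
  have hp := dom_zero_of_describes hpμ
  obtain ⟨w, hw, hw0, hwμ, hwle, hweq⟩ := exists_weights_of_describes hpμ
  have hsum := sum_weights_le_one μ w hw0 hwμ hwle
  set F : ℕ → ℝ := fun e => ∑ j ∈ Finset.range e, (w j : ℝ) / 2 ^ (j + 1) with hF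
  have hFmono : Monotone F := fun i j hij =>
    Finset.sum_le_sum_of_subset_of_nonneg (Finset.range_mono hij) fun _ _ _ => by positivity
  have hxpos : 0 < (μ x).toReal := ENNReal.toReal_pos hx (μ.apply_ne_top x)
  have hxle : (μ x).toReal ≤ 1 := ENNReal.toReal_le_of_le_ofReal zero_le_one (by
    simpa using μ.coe_le_one x)
  set t := -Real.logb 2 (μ x).toReal with ht
  have ht0 : 0 ≤ t := by
    have := Real.logb_nonpos one_lt_two hxpos.le hxle
    linarith
  -- `2 ^ (-k) ≤ μ x / 4`, so that the event `(x, k)` passes the threshold `3 / 2 ^ k ≤ μ x`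
  set k := ⌈t⌉₊ + 2 with hk
  have hkt : (k : ℝ) ≤ t + 3 := by
    have := Nat.ceil_lt_add_one ht0
    push_cast [hk]
    linarith
  have hkμ : 3 / 2 ^ k ≤ (μ x).toReal := by
    have h1 : (2 : ℝ) ^ (-t) = (μ x).toReal := by
      rw [ht, neg_neg, Real.rpow_logb two_pos (by norm_num) hxpos]
    have h2 : (2 : ℝ) ^ (-(⌈t⌉₊ : ℝ)) ≤ (2 : ℝ) ^ (-t) :=
      Real.rpow_le_rpow_of_exponent_le one_le_two (neg_le_neg (Nat.le_ceil t))
    rw [Real.rpow_neg two_pos.le, Real.rpow_natCast, h1] at h2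
    refine le_trans ?_ h2
    rw [hk, pow_add, div_le_iff₀ (by positivity)]
    have : (0 : ℝ) < 2 ^ ⌈t⌉₊ := by positivity
    field_simp
    norm_num
  set e := encode (x, k) with he
  have heu : e.unpair = (encode x, k) := by rw [he, encode_prod_val]; simp
  have hke : k ≤ e := by rw [he, encode_prod_val]; exact Nat.right_le_pair _ _
  have hFe : F e + 2 / 2 ^ (k + 2) ≤ F (e + 1) := by
    have h1 : (w e : ℝ) / 2 ^ (e + 1) = 2 / 2 ^ (k + 2) := by
      rw [he, hweq x k hkμ, ← he, div_eq_div_iff (by positivity) (by positivity)]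
      push_cast
      rw [← pow_add, ← pow_succ']
      congr 1
      omega
    simp only [hF]
    rw [Finset.sum_range_succ, h1]
  obtain ⟨r, hr, hrF⟩ := exists_isCodewordIn
    (Finset.sum_nonneg fun _ _ => by positivity) (hsum (e + 1)) hFe
  refine ⟨p ++ r, ?_, ?_⟩
  · refine hVspec ((p, r), e) (encode x)
      ((mem_eventDecoder_iff hw hp).2 ⟨by rw [heu], by rw [heu, hr], hrF⟩) ?_ 0
    rintro ⟨⟨p', r'⟩, e'⟩ x' hx' hcomp
    dsimp only at hcomp ⊢
    have hp' : (U p' 0).Dom := by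
      obtain ⟨u, hu, -⟩ := Part.mem_bind_iff.1 hx'
      exact Part.dom_iff_mem.2 ⟨u, hu⟩
    -- Halting on input `0` delimits the description: comparable words start with the same one.
    have hpp : p' <+: p ∨ p <+: p' := by
      rcases hcomp with h | h
      · exact List.prefix_or_prefix_of_prefix ((List.prefix_append p' r').trans h)
          (List.prefix_append p r)
      · exact List.prefix_or_prefix_of_prefix (List.prefix_append p' r')
          ((List.prefix_append p r).trans h)
    obtain rfl : p' = p := hpp.elim (hU.prefixFree 0 _ _ hp' hp)
      fun h => (hU.prefixFree 0 _ _ hp hp' h).symm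
    rw [List.prefix_append_right_inj, List.prefix_append_right_inj] at hcomp
    obtain ⟨rfl, hr', hrF'⟩ := (mem_eventDecoder_iff hw hp').1 hx'
    obtain ⟨h1, h2⟩ := hrF'.lt_of_comparable hrF hcomp
    -- The intervals of distinct events do not overlap.
    have hee : e' = e := by
      have := hFmono.reflect_lt h1
      have := hFmono.reflect_lt h2
      omega
    rw [hee, heu] at hr' ⊢
    refine ⟨?_, rfl⟩
    rw [hcomp.elim (fun h => h.eq_of_length (hr'.trans hr.symm))
      fun h => (h.eq_of_length (hr.trans hr'.symm)).symm]
  · rw [List.length_append, hr]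
    push_cast
    linarith

/-! ### Program lengths and the minimum -/

theorem exists_iInf_length_eq {P : List Bool → Prop} (h : ∃ p, P p) :
    ∃ p, P p ∧ (⨅ (q : List Bool) (_ : P q), (q.length : ℕ∞)) = (p.length : ℕ∞) := by
  obtain ⟨p, hp, hmin⟩ := exists_minimalFor_of_wellFoundedLT P List.length h
  refine ⟨p, hp, le_antisymm (iInf₂_le p hp) (le_iInf₂ fun q hq => ?_)⟩
  rcases le_total p.length q.length with hpq | hpq
  · exact_mod_cast hpq
  · exact_mod_cast hmin hq hpq

/-- A program describes at most one distribution, as it determines all values to any precision. -/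
theorem eq_of_describes {α : Type*} [Primcodable α] {U : Machine} {p : List Bool}
    {μ ν : PMF (List α)} (hμ : Describes U p μ) (hν : Describes U p ν) : μ = ν := by
  refine PMF.ext fun y => (ENNReal.toReal_eq_toReal_iff' (μ.apply_ne_top y)
    (ν.apply_ne_top y)).1 ?_
  have hdist : ∀ k : ℕ, |(μ y).toReal - (ν y).toReal| ≤ 2 * (1 / 2) ^ k := by
    intro k
    obtain ⟨n, hn, hnμ⟩ := hμ y k
    obtain ⟨n', hn', hnν⟩ := hν y k
    obtain rfl := Part.mem_unique hn hn'
    rw [div_pow, one_pow]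
    rw [abs_le] at *
    constructor <;> linarith
  have hlim : Filter.Tendsto (fun k : ℕ => 2 * (1 / 2 : ℝ) ^ k) Filter.atTop (nhds (2 * 0)) :=
    (tendsto_pow_atTop_nhds_zero_of_lt_one (by norm_num) (by norm_num)).const_mul 2
  have h0 := ge_of_tendsto' hlim hdist
  rw [mul_zero] at h0
  exact sub_eq_zero.1 (abs_nonpos_iff.1 h0)

theorem logb_toReal_nonpos {α : Type*} (μ : PMF (List α)) (x : List α) :
    Real.logb 2 (μ x).toReal ≤ 0 :=
  Real.logb_nonpos one_lt_two ENNReal.toReal_nonneg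
    (ENNReal.toReal_le_of_le_ofReal zero_le_one (by simpa using μ.coe_le_one x))

/-- A finite description length is realised by a program describing the distribution. -/
theorem descriptionLength_eq_top_or {α : Type*} [Primcodable α] (U : Machine) (μ : PMF (List α))
    (x : List α) : descriptionLength U μ x = ⊤ ∨ ∃ p, Describes U p μ ∧ μ x ≠ 0 ∧
      descriptionLength U μ x = ((p.length - Real.logb 2 (μ x).toReal : ℝ) : EReal) := by
  by_cases hx : μ x = 0
  · left
    rw [descriptionLength, codeLength, if_pos hx]
    exact EReal.add_top_of_ne_bot (EReal.coe_ennreal_ne_bot _)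
  by_cases hp : ∃ p, Describes U p μ
  · right
    obtain ⟨p, hp, hlen⟩ := exists_iInf_length_eq hp
    refine ⟨p, hp, hx, ?_⟩
    rw [descriptionLength, codeLength, if_neg hx, distributionLength, hlen, sub_eq_add_neg,
      EReal.coe_add]
    norm_cast
  · left
    have : distributionLength U μ = ⊤ :=
      iInf₂_eq_top.2 fun p h => absurd ⟨p, h⟩ hp
    rw [descriptionLength, codeLength, if_neg hx, this]
    simp

/-- Each value up to `N` comes from a distribution described by one of the finitely many programs of
length at most `N`. -/
theorem finite_setOf_descriptionLength_le {α : Type*} [Primcodable α] (U : Machine) (x : List α)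
    (N : ℕ) : {L : EReal | (∃ μ : PMF (List α), L = descriptionLength U μ x) ∧
      L ≤ ((N : ℝ) : EReal)}.Finite := by
  classical
  refine ((List.finite_length_le Bool N).image fun p =>
    if h : ∃ μ : PMF (List α), Describes U p μ then descriptionLength U h.choose x else 0).subset ?_
  rintro L ⟨⟨μ, rfl⟩, hL⟩
  rcases descriptionLength_eq_top_or U μ x with h | ⟨p, hp, -, h⟩
  · rw [h] at hL
    exact absurd (top_le_iff.1 hL) (EReal.coe_ne_top _)
  · refine ⟨p, ?_, ?_⟩
    · rw [h, EReal.coe_le_coe_iff] at hL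
      have := logb_toReal_nonpos μ x
      have hle : (p.length : ℝ) ≤ N := by linarith
      exact_mod_cast hle
    · have hex : ∃ μ : PMF (List α), Describes U p μ := ⟨μ, hp⟩
      dsimp only
      rw [dif_pos hex, eq_of_describes hex.choose_spec hp]

/-- Every number is the output of some program: simulate the machine that outputs it on the empty
program. -/
theorem exists_program_output {U : Machine} (hU : IsUniversalPrefixMachine U) (n : ℕ) :
    ∃ p, n ∈ U p 0 := by
  let V : Machine := fun p _ => ((if p = [] then some n else none : Option ℕ) : Part ℕ)
  have hV : IsPrefixMachine V := by
    refine ⟨Computable.ofOption (Primrec.ite (Primrec.eq.comp Primrec.fst (Primrec.const []))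
      (Primrec.const (some n)) (Primrec.const none)).to_comp, fun z p q hp hq _ => ?_⟩
    have hnil : ∀ r : List Bool, (V r z).Dom → r = [] := by
      intro r hr
      by_contra hne
      simp [V, hne] at hr
    rw [hnil p hp, hnil q hq]
  obtain ⟨c, hc⟩ := hU.simulates V hV
  obtain ⟨p, -, hp⟩ := hc []
  exact ⟨p, by simp [hp, V]⟩

theorem abs_indicator_div_sub_pure {α : Type*} (x y : List α) (k : ℕ) [Decidable (y = x)] :
    |((if y = x then 2 ^ k else 0 : ℕ) : ℝ) / 2 ^ k - (PMF.pure x y).toReal| ≤ 1 / 2 ^ k := by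
  rw [PMF.pure_apply]
  split_ifs <;> simp

theorem isComputableDistribution_pure {α : Type*} [Primcodable α] (x : List α) :
    IsComputableDistribution (PMF.pure x) := by
  classical
  refine ⟨fun y k => if y = x then 2 ^ k else 0, ?_, fun y k => abs_indicator_div_sub_pure x y k⟩
  exact (Primrec.ite (Primrec.eq.comp Primrec.fst (Primrec.const x))
    (primrec_two_pow.comp Primrec.snd) (Primrec.const 0)).to_comp

open Encodable in
/-- A program for `x` turns into a program for the point mass at `x` at bounded extra cost: the
machine reads the string to compare with off the original program run on the blank input. -/
theorem exists_describes_pure (α : Type*) [Primcodable α] {U : Machine}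
    (hU : IsUniversalPrefixMachine U) :
    ∃ c : ℕ, ∀ (x : List α) (p : List Bool), encode x ∈ U p 0 →
      ∃ p' : List Bool, p'.length ≤ p.length + c ∧ Describes U p' (PMF.pure x) := by
  classical
  let V : Machine := fun p z => (U p 0).map fun n => if z.unpair.1 = n then 2 ^ z.unpair.2 else 0
  have hV : IsPrefixMachine V := by
    refine ⟨?_, fun z p q hp hq hpq => hU.isPrefixMachine.prefixFree 0 p q hp hq hpq⟩
    have hdom : Partrec fun a : List Bool × ℕ => U a.1 0 :=
      Partrec₂.comp hU.isPrefixMachine.partrec Computable.fst (Computable.const 0)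
    have hz : Primrec fun a : (List Bool × ℕ) × ℕ => a.1.2.unpair :=
      Primrec.unpair.comp (Primrec.snd.comp Primrec.fst)
    exact hdom.map (Primrec.ite (Primrec.eq.comp (Primrec.fst.comp hz) Primrec.snd)
      (primrec_two_pow.comp (Primrec.snd.comp hz)) (Primrec.const 0)).to_comp.to₂
  obtain ⟨c, hc⟩ := hU.simulates V hV
  refine ⟨c, fun x p hp => ?_⟩
  obtain ⟨p', hlen, hp'⟩ := hc p
  refine ⟨p', hlen, fun y k => ⟨if y = x then 2 ^ k else 0, ?_, abs_indicator_div_sub_pure x y k⟩⟩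
  rw [hp']
  simp [V, Part.eq_some_iff.2 hp, encode_prod_val, encode_injective.eq_iff]

theorem lemmaA1 {α : Type*} [Primcodable α] (U : Machine) (hU : IsUniversalPrefixMachine U) :
    ∃ c c' : ℝ, ∀ x : List α, ∃ (K : ℕ) (m : ℝ),
      kolmogorovComplexity U x = (K : ℕ∞) ∧
      IsLeast {L : EReal | ∃ μ : PMF (List α),
        IsComputableDistribution μ ∧ L = descriptionLength U μ x} (m : EReal) ∧
      (K : ℝ) ≤ m + c ∧ m ≤ (K : ℝ) + c' := by
  obtain ⟨V, hV, hVspec⟩ := exists_isPrefixMachine_decoding α hU.isPrefixMachine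
  obtain ⟨c, hc⟩ := hU.simulates V hV
  obtain ⟨c', hc'⟩ := exists_describes_pure α hU
  refine ⟨c + 5, c', fun x => ?_⟩
  obtain ⟨p₀, hp₀, hK⟩ := exists_iInf_length_eq (exists_program_output hU (Encodable.encode x))
  obtain ⟨d, hdlen, hd⟩ := hc' x p₀ hp₀
  set S := {L : EReal | ∃ μ : PMF (List α),
    IsComputableDistribution μ ∧ L = descriptionLength U μ x} with hS
  have hpure : descriptionLength U (PMF.pure x) x ≤ (((p₀.length + c' : ℕ) : ℝ) : EReal) := by
    have hle : distributionLength U (PMF.pure x) ≤ ((p₀.length + c' : ℕ) : ℕ∞) :=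
      (iInf₂_le d hd).trans (by exact_mod_cast hdlen)
    have hcode : codeLength (PMF.pure x) x = 0 := by simp [codeLength]
    rw [descriptionLength, hcode, add_zero]
    refine (EReal.coe_ennreal_le_coe_ennreal_iff.2 (ENat.toENNReal_le.2 hle)).trans_eq ?_
    norm_cast
  obtain ⟨L, ⟨hLS, hLle⟩, hLmin⟩ := Set.exists_min_image
    {L | L ∈ S ∧ L ≤ (((p₀.length + c' : ℕ) : ℝ) : EReal)} id
    ((finite_setOf_descriptionLength_le U x (p₀.length + c')).subset
      fun L hL => ⟨hL.1.imp fun _ h => h.2, hL.2⟩)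
    ⟨_, ⟨PMF.pure x, isComputableDistribution_pure x, rfl⟩, hpure⟩
  have hleast : IsLeast S L := by
    refine ⟨hLS, fun L' hL' => ?_⟩
    rcases le_total L' (((p₀.length + c' : ℕ) : ℝ) : EReal) with h | h
    · exact hLmin L' ⟨hL', h⟩
    · exact hLle.trans h
  obtain ⟨μ, -, rfl⟩ := hLS
  rcases descriptionLength_eq_top_or U μ x with h | ⟨p, hp, hx, h⟩
  · rw [h] at hLle
    exact absurd (top_le_iff.1 hLle) (EReal.coe_ne_top _)
  rw [h] at hleast hLle
  refine ⟨p₀.length, _, hK, hleast, ?_, ?_⟩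
  · obtain ⟨q, hq, hqlen⟩ := hVspec p μ hp x hx
    obtain ⟨q', hq'len, hq'⟩ := hc q
    have h1 : (p₀.length : ℕ∞) ≤ q'.length := hK ▸ iInf₂_le q' (by rw [hq']; exact hq)
    have h2 : (p₀.length : ℝ) ≤ q'.length := by exact_mod_cast h1
    have h3 : (q'.length : ℝ) ≤ q.length + c := by exact_mod_cast hq'len
    linarith
  · have := EReal.coe_le_coe_iff.1 hLle
    push_cast at this
    exact this
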